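/- Let $n\ge 2$. Let $\mathbb{L}^{n+2}$ be Minkowski space with coordinates $(x_0,\dots,x_{n+1})$ and the Lorentzian product $\langle x,y\rangle=-x_0y_0+\sum_{i=1}^{n+1}x_iy_i$, let $\mathbb{H}^{n+1}=\{x\in\mathbb{L}^{n+2}:\langle x,x\rangle=-1,\ x_0>0\}$, and let $g_0$ be the round metric of the unit sphere $\mathbb{S}^n\subset\mathbb{R}^{n+1}$. Let $\phi:\mathbb{S}^n\to\mathbb{H}^{n+1}$ be a horospherical ovaloid, that is, a smooth immersion that can be oriented so that, at every point $p$, the hypersurface meets the horosphere tangent to it at $\phi(p)$, with the same (inner) unit normal, only at $p$ in some neighbourhood of $p$, and the distance to this horosphere does not vanish up to second order at $p$ in any direction. Let $\eta$ be a smooth unit normal field of $\phi$ in $\mathbb{H}^{n+1}$ (either orientation is allowed; in particular the one for which all principal curvatures are $<1$). Put $\psi=\phi+\eta=(\psi_0,\dots,\psi_{n+1})$, a map into the positive light cone, and $\rho=\log\psi_0$. Assume that the hyperbolic Gauss map $G=\psi_0^{-1}(\psi_1,\dots,\psi_{n+1})$ satisfies $G(x)=x$ for all $x\in\mathbb{S}^n$.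 Let $g=\langle d\psi,d\psi\rangle$ be the horospherical metric of $\phi$, and let $I_\phi=\langle d\phi,d\phi\rangle$ and $II_\phi=-\langle d\phi,d\eta\rangle$ be the first and second fundamental forms. Then $$g=e^{2\rho}g_0,$$ and the Schouten tensor ${\rm Sch}_g$ of $g$, which is $\frac{1}{n-2}\bigl({\rm Ric}_g-\frac{S(g)}{2(n-1)}\,g\bigr)$ if $n>2$ (with ${\rm Ric}_g$, $S(g)$ the Ricci and scalar curvatures of $g$), and which is defined by the next formula if $n=2$, is $${\rm Sch}_g=-\nabla^{2}\rho+d\rho\otimes d\rho-\tfrac12\left(-1+|\nabla\rho|^2\right)g_0,$$ where $\nabla^2\rho$ and $|\nabla\rho|$ are the Hessian of $\rho$ and the norm of its gradient with respect to $g_0$. Moreover, at every $x\in\mathbb{S}^n$ and for every basis $e_1,\dots,e_n$ of $T_x\mathbb{S}^n$ that is orthonormal for $g_0$, $$\bigl(I_\phi(e_i,e_j)\bigr)_{i,j}=\frac{e^{-2\rho(x)}}{4}\Bigl(\bigl(g(e_i,e_j)-2\,{\rm Sch}_g(e_i,e_j)\bigr)_{i,j}\Bigr)^2,$$ where the square is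 that of an $n\times n$ matrix, and $$II_\phi=I_\phi-\tfrac12\,g+{\rm Sch}_g .$$ -/

import Mathlib

open scoped Manifold ContDiff InnerProductSpace Topology

noncomputable section

namespace HoroGeom

/-! ### Riemannian geometry in coordinates

`Coord n` is `ℝⁿ`.  A metric on it is given by its matrix `h u = (hᵢⱼ(u))`. -/

/-- The coordinate space `ℝⁿ`. -/
abbrev Coord (n : ℕ) : Type := EuclideanSpace ℝ (Fin n)

/-- The partial derivative `∂ᵢ f`. -/
def pderiv {n : ℕ} (i : Fin n) (f : Coord n → ℝ) (u : Coord n) : ℝ :=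
  fderiv ℝ f u (EuclideanSpace.single i (1 : ℝ))

/-- The Christoffel symbol
`Γᵏᵢⱼ = ½ ∑ₗ hᵏˡ (∂ᵢ hⱼₗ + ∂ⱼ hᵢₗ - ∂ₗ hᵢⱼ)` of the Levi-Civita connection of `h`. -/
def christoffel {n : ℕ} (h : Coord n → Matrix (Fin n) (Fin n) ℝ) (k i j : Fin n)
    (u : Coord n) : ℝ :=
  (1 / 2) * ∑ l, (h u)⁻¹ k l *
    (pderiv i (fun v => h v j l) u + pderiv j (fun v => h v i l) u
      - pderiv l (fun v => h v i j) u)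

/-- The Ricci tensor
`Rᵢⱼ = ∑ₖ (∂ₖ Γᵏᵢⱼ - ∂ⱼ Γᵏᵢₖ) + ∑ₖₗ (Γᵏₖₗ Γˡᵢⱼ - Γᵏⱼₗ Γˡᵢₖ)` of `h`. -/
def coordRicci {n : ℕ} (h : Coord n → Matrix (Fin n) (Fin n) ℝ) (i j : Fin n)
    (u : Coord n) : ℝ :=
  (∑ k, (pderiv k (christoffel h k i j) u - pderiv j (christoffel h k i k) u))
    + ∑ k, ∑ l, (christoffel h k k l u * christoffel h l i j u
        - christoffel h k j l u * christoffel h l i k u)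

/-- The scalar curvature `S = ∑ᵢⱼ hⁱʲ Rᵢⱼ` of `h`. -/
def coordScalar {n : ℕ} (h : Coord n → Matrix (Fin n) (Fin n) ℝ) (u : Coord n) : ℝ :=
  ∑ i, ∑ j, (h u)⁻¹ i j * coordRicci h i j u

/-- The Schouten tensor `(Ric - S / (2 (n - 1)) h) / (n - 2)` of `h`, for `n > 2`. -/
def coordSchouten {n : ℕ} (h : Coord n → Matrix (Fin n) (Fin n) ℝ) (i j : Fin n)
    (u : Coord n) : ℝ :=
  (1 / ((n : ℝ) - 2)) *
    (coordRicci h i j u - coordScalar h u / (2 * ((n : ℝ) - 1)) * h u i j)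

/-- The second covariant derivative `∂ᵢ∂ⱼ f - ∑ₖ Γᵏᵢⱼ ∂ₖ f` of `f` with respect to `h`. -/
def coordHessian {n : ℕ} (h : Coord n → Matrix (Fin n) (Fin n) ℝ) (f : Coord n → ℝ)
    (i j : Fin n) (u : Coord n) : ℝ :=
  pderiv i (pderiv j f) u - ∑ k, christoffel h k i j u * pderiv k f u

/-- The squared norm `∑ᵢⱼ hⁱʲ ∂ᵢf ∂ⱼf` of the gradient of `f` with respect to `h`. -/
def coordGradNormSq {n : ℕ} (h : Coord n → Matrix (Fin n) (Fin n) ℝ) (f : Coord n → ℝ)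
    (u : Coord n) : ℝ :=
  ∑ i, ∑ j, (h u)⁻¹ i j * (pderiv i f u * pderiv j f u)

/-! ### Tensors on a manifold -/

section Manifolds

variable {n : ℕ} {M : Type*} [TopologicalSpace M] [ChartedSpace (Coord n) M]

variable (n M) in
/-- Fields of `(0,2)`-tensors on the `n`-manifold `M`. -/
abbrev TensorField : Type _ :=
  (x : M) → TangentSpace (𝓡 n) x → TangentSpace (𝓡 n) x → ℝ

/-- The matrix of the tensor field `g` in the preferred chart around `x`. -/
def chartMatrix (g : TensorField n M) (x : M) (u : Coord n) : Matrix (Fin n) (Fin n) ℝ :=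
  Matrix.of fun i j =>
    g ((extChartAt (𝓡 n) x).symm u)
      (mfderiv 𝓘(ℝ, Coord n) (𝓡 n) (extChartAt (𝓡 n) x).symm u
        (EuclideanSpace.single i (1 : ℝ)))
      (mfderiv 𝓘(ℝ, Coord n) (𝓡 n) (extChartAt (𝓡 n) x).symm u
        (EuclideanSpace.single j (1 : ℝ)))

/-- The `i`-th component of the tangent vector `X` at `x` in the preferred chart around `x`. -/
def chartComponent (x : M) (X : TangentSpace (𝓡 n) x) (i : Fin n) : ℝ :=
  (mvfderiv (𝓡 n) (extChartAt (𝓡 n) x) x X) i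

/-- The tensor at `x` whose matrix in the preferred chart around `x` is `T`. -/
def ofChartMatrix (x : M) (T : Fin n → Fin n → ℝ) (X Y : TangentSpace (𝓡 n) x) : ℝ :=
  ∑ i, ∑ j, T i j * (chartComponent x X i * chartComponent x Y j)

/-- The Schouten tensor of the Riemannian metric `g` on a manifold of dimension `n > 2`. -/
def schoutenTensor (g : TensorField n M) : TensorField n M := fun x =>
  ofChartMatrix x fun i j => coordSchouten (chartMatrix g x) i j (extChartAt (𝓡 n) x x)

/-- The Hessian `∇²f` of `f` with respect to the Riemannian metric `g`. -/
def hessian (g : TensorField n M) (f : M → ℝ) : TensorField n M := fun x =>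
  ofChartMatrix x fun i j =>
    coordHessian (chartMatrix g x) (f ∘ (extChartAt (𝓡 n) x).symm) i j (extChartAt (𝓡 n) x x)

/-- The squared norm `|∇f|²` of the gradient of `f` with respect to the Riemannian metric `g`. -/
def gradNormSq (g : TensorField n M) (f : M → ℝ) (x : M) : ℝ :=
  coordGradNormSq (chartMatrix g x) (f ∘ (extChartAt (𝓡 n) x).symm) (extChartAt (𝓡 n) x x)

end Manifolds

/-! ### Hyperbolic space in the Minkowski model -/

/-- The Minkowski space `𝕃ⁿ⁺²`; the first factor carries the coordinate `x₀`. -/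
abbrev Minkowski (n : ℕ) : Type := ℝ × EuclideanSpace ℝ (Fin (n + 1))

/-- The Lorentzian product `-x₀ y₀ + x₁ y₁ + ⋯ + xₙ₊₁ yₙ₊₁`. -/
def lorentz {n : ℕ} (v w : Minkowski n) : ℝ := -(v.1 * w.1) + ⟪v.2, w.2⟫_ℝ

/-- The hyperbolic space `ℍⁿ⁺¹`. -/
def hyperbolicSpace (n : ℕ) : Set (Minkowski n) := {y | lorentz y y = -1 ∧ 0 < y.1}

/-- The hyperbolic distance. -/
def hypDist {n : ℕ} (y z : Minkowski n) : ℝ := Real.arcosh (-lorentz y z)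

/-- The horosphere of `ℍⁿ⁺¹` that corresponds to the vector `v` of the positive light cone. It is
the hypersurface which, with its inner unit normal, has `v` as its constant light cone map. -/
def horosphere {n : ℕ} (v : Minkowski n) : Set (Minkowski n) :=
  {y ∈ hyperbolicSpace n | lorentz y v = -1}

/-- The distance in `ℍⁿ⁺¹` from `y` to the set `A`. -/
def hypDistTo {n : ℕ} (A : Set (Minkowski n)) (y : Minkowski n) : ℝ := sInf (hypDist y '' A)

section Hypersurfaces

variable {n : ℕ} {M : Type*} [TopologicalSpace M] [ChartedSpace (Coord n) M]

/-- `φ` is a smooth immersed hypersurface of `ℍⁿ⁺¹`. -/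
structure IsImmersedHypersurface (φ : M → Minkowski n) : Prop where
  smooth : ContMDiff (𝓡 n) 𝓘(ℝ, Minkowski n) ∞ φ
  mem_hyperbolicSpace : ∀ x, φ x ∈ hyperbolicSpace n
  injective_mvfderiv : ∀ x, Function.Injective (mvfderiv (𝓡 n) φ x)

/-- `η` is a smooth unit normal field in `ℍⁿ⁺¹` along the hypersurface `φ`: an orientation. -/
structure IsUnitNormal (φ η : M → Minkowski n) : Prop where
  smooth : ContMDiff (𝓡 n) 𝓘(ℝ, Minkowski n) ∞ η
  unit : ∀ x, lorentz (η x) (η x) = 1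
  tangent : ∀ x, lorentz (η x) (φ x) = 0
  normal : ∀ x X, lorentz (η x) (mvfderiv (𝓡 n) φ x X) = 0

/-- The light cone map `ψ = φ + η`. -/
def lightConeMap (φ η : M → Minkowski n) (x : M) : Minkowski n := φ x + η x

/-- The hyperbolic Gauss map `G = (ψ₁, …, ψₙ₊₁) / ψ₀`, with values in `𝕊ⁿ ⊆ ℝⁿ⁺¹`. -/
def hyperbolicGaussMap (φ η : M → Minkowski n) (x : M) : EuclideanSpace ℝ (Fin (n + 1)) :=
  (lightConeMap φ η x).1⁻¹ • (lightConeMap φ η x).2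

/-- The function `ρ` with `e^ρ = ψ₀`, the logarithm of the horospherical support function. -/
def logSupport (φ η : M → Minkowski n) (x : M) : ℝ := Real.log (lightConeMap φ η x).1

/-- The horospherical metric `⟨dψ, dψ⟩`: the pullback by the tangent horosphere map of the
degenerate metric of the space of horospheres, which is the positive light cone. -/
def horosphericalMetric (φ η : M → Minkowski n) : TensorField n M := fun x X Y =>
  lorentz (mvfderiv (𝓡 n) (lightConeMap φ η) x X) (mvfderiv (𝓡 n) (lightConeMap φ η) x Y)

/-- The first fundamental form `I = ⟨dφ, dφ⟩`. -/
def firstForm (φ : M → Minkowski n) : TensorField n M := fun x X Y =>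
  lorentz (mvfderiv (𝓡 n) φ x X) (mvfderiv (𝓡 n) φ x Y)

/-- The second fundamental form `II = -⟨dφ, dη⟩`. -/
def secondForm (φ η : M → Minkowski n) : TensorField n M := fun x X Y =>
  -lorentz (mvfderiv (𝓡 n) φ x X) (mvfderiv (𝓡 n) η x Y)

/-- The hypersurface `φ` with unit normal `η` is horospherically convex at `p`: near `p` it meets
the horosphere that is tangent to it at `p`, with inner unit normal `η p`, only at `p`, and along
no regular curve through `p` does the distance to this horosphere vanish to second order. -/
def IsHorosphericallyConvexAt (φ η : M → Minkowski n) (p : M) : Prop :=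
  (∀ᶠ q in 𝓝[≠] p, φ q ∉ horosphere (lightConeMap φ η p)) ∧
  ∀ α : ℝ → M, ContMDiff 𝓘(ℝ, ℝ) (𝓡 n) ∞ α → α 0 = p →
    mfderiv 𝓘(ℝ, ℝ) (𝓡 n) α 0 ≠ 0 →
    ¬ (fun t => hypDistTo (horosphere (lightConeMap φ η p)) (φ (α t)))
        =o[𝓝 0] (fun t : ℝ => t ^ 2)

/-- A horospherical ovaloid: a compact immersed hypersurface that can be oriented so that it is
horospherically convex at every point. -/
def IsHorosphericalOvaloid (φ : M → Minkowski n) : Prop :=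
  CompactSpace M ∧ IsImmersedHypersurface φ ∧
    ∃ η : M → Minkowski n, IsUnitNormal φ η ∧ ∀ p, IsHorosphericallyConvexAt φ η p

end Hypersurfaces

/-! ### Conformal metrics on the sphere -/

/-- The unit sphere `𝕊ⁿ` of `ℝⁿ⁺¹`. -/
abbrev Sph (n : ℕ) : Type := Metric.sphere (0 : EuclideanSpace ℝ (Fin (n + 1))) 1

/-- The round metric `g₀` of `𝕊ⁿ`. -/
def roundMetric (n : ℕ) : TensorField n (Sph n) := fun x X Y =>
  ⟪mvfderiv (𝓡 n) ((↑) : Sph n → EuclideanSpace ℝ (Fin (n + 1))) x X,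
    mvfderiv (𝓡 n) ((↑) : Sph n → EuclideanSpace ℝ (Fin (n + 1))) x Y⟫_ℝ

/-- The conformal metric `e^{2ρ} g₀` on `𝕊ⁿ`. -/
def conformalMetric {n : ℕ} (ρ : Sph n → ℝ) : TensorField n (Sph n) := fun x X Y =>
  Real.exp (2 * ρ x) * roundMetric n x X Y

/-- The tensor `-∇²ρ + dρ ⊗ dρ - ½ (-1 + |∇ρ|²) g₀` on `𝕊ⁿ`. -/
def conformalSchoutenFormula {n : ℕ} (ρ : Sph n → ℝ) : TensorField n (Sph n) := fun x X Y =>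
  -hessian (roundMetric n) ρ x X Y + mvfderiv (𝓡 n) ρ x X * mvfderiv (𝓡 n) ρ x Y
    - (1 / 2) * (-1 + gradNormSq (roundMetric n) ρ x) * roundMetric n x X Y

/-- The Schouten tensor of `e^{2ρ} g₀` on `𝕊ⁿ`, `n ≥ 2`. For `n > 2` it is that of Riemannian
geometry; this is not available for `n = 2`, where the tensor is defined by the formula. -/
def schouten {n : ℕ} (ρ : Sph n → ℝ) : TensorField n (Sph n) :=
  if 2 < n then schoutenTensor (conformalMetric ρ) else conformalSchoutenFormula ρ

end HoroGeom

end

namespace HoroGeom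
-- Curvature of the conformally flat metric `e^{2σ} δ` on `ℝⁿ`.
section ConformallyFlat
variable {n : ℕ}

/-! Everything about the hypersurface is read off from the pairing ⟨dφ, dψ⟩. For either orientation
ψ = φ + η is null, ⟨φ, ψ⟩ = -1 and ⟨dφ, ψ⟩ = 0. Hence ψ₀ > 0, and G = id means ψ = e^ρ (1, x). Since
(1, x) is null and orthogonal to (0, dx), the dρ terms of ⟨dψ, dψ⟩ drop out and g = e^{2ρ} g₀.

Divide ⟨φ, ψ⟩ = -1 by e^ρ to get ⟨φ, (1, x)⟩ = -e^{-ρ}. One derivative, with ⟨dφ, ψ⟩ = 0, gives the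
components of φ tangent to the sphere (`inner_fderiv_stereoParam_eq`). A second one gives ⟨dφ, (0,
dx)⟩ up to the component of φ along x, which ⟨φ, φ⟩ = -1 determines (`exp_mul_inner_fderiv`). The
outcome is ⟨dφ, dψ⟩ = ½ g - Sch_g (`lorentz_mvfderiv_lightConeMap`). As dη = dψ - dφ, this is the
formula for II. Being orthogonal to (1, x), dφ is a multiple of that null vector plus a vector
tangent to the sphere; only the tangent part counts in I, and its components are e^{-ρ} ⟨dφ, dψ⟩. By
symmetry of ½ g - Sch_g, the matrix of I is e^{-2ρ} times its square.

The Schouten formula is separate. Tensors at x are computed in the preferred chart around x, the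
stereographic projection from -x, centred at x. There e^{2ρ} g₀ is e^{2(ρ + τ)} δ with τ =
`stereoFactor`, and `coordSchouten_flatConformal` applies. At the centre τ and dτ vanish and ∂ᵢ∂ⱼτ =
-½ δᵢⱼ, which produces the summand ½ g₀. -/

theorem pderiv_congr_fun {i : Fin n} {f g : Coord n → ℝ} (h : ∀ u, f u = g u) (u : Coord n) :
    pderiv i f u = pderiv i g u := by rw [funext h]

theorem contDiff_pderiv {f : Coord n → ℝ} (hf : ContDiff ℝ ∞ f) (i : Fin n) :
    ContDiff ℝ ∞ (pderiv i f) :=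
  (hf.fderiv_right (m := ∞) (by simp)).clm_apply contDiff_const

theorem pderiv_add {f g : Coord n → ℝ} {u : Coord n} (hf : DifferentiableAt ℝ f u)
    (hg : DifferentiableAt ℝ g u) (i : Fin n) :
    pderiv i (fun v => f v + g v) u = pderiv i f u + pderiv i g u := by
  simp [pderiv, fderiv_fun_add hf hg]

theorem pderiv_sub {f g : Coord n → ℝ} {u : Coord n} (hf : DifferentiableAt ℝ f u)
    (hg : DifferentiableAt ℝ g u) (i : Fin n) :
    pderiv i (fun v => f v - g v) u = pderiv i f u - pderiv i g u := by
  simp [pderiv, fderiv_fun_sub hf hg]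

theorem pderiv_const_mul {f : Coord n → ℝ} {u : Coord n} (hf : DifferentiableAt ℝ f u)
    (c : ℝ) (i : Fin n) : pderiv i (fun v => c * f v) u = c * pderiv i f u := by
  simp [pderiv, fderiv_const_mul hf]

theorem pderiv_exp {f : Coord n → ℝ} {u : Coord n} (hf : DifferentiableAt ℝ f u) (i : Fin n) :
    pderiv i (fun v => Real.exp (f v)) u = Real.exp (f u) * pderiv i f u := by
  simp [pderiv, fderiv_exp hf]

/-- The conformally flat metric `e^{2σ} δ` on `ℝⁿ`. -/
noncomputable def flatConformal (σ : Coord n → ℝ) (u : Coord n) : Matrix (Fin n) (Fin n) ℝ :=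
  Real.exp (2 * σ u) • (1 : Matrix (Fin n) (Fin n) ℝ)

theorem flatConformal_apply (σ : Coord n → ℝ) (u : Coord n) (i j : Fin n) :
    flatConformal σ u i j = (1 : Matrix (Fin n) (Fin n) ℝ) i j * Real.exp (2 * σ u) := by
  simp [flatConformal, mul_comm]

theorem flatConformal_inv (σ : Coord n → ℝ) (u : Coord n) :
    (flatConformal σ u)⁻¹ = Real.exp (-(2 * σ u)) • (1 : Matrix (Fin n) (Fin n) ℝ) := by
  apply Matrix.inv_eq_right_inv
  rw [flatConformal, smul_mul_smul_comm, ← Real.exp_add]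
  simp

theorem pderiv_flatConformal {σ : Coord n → ℝ} (hσ : ContDiff ℝ ∞ σ) (k i j : Fin n)
    (u : Coord n) : pderiv k (fun v => flatConformal σ v i j) u =
      (1 : Matrix (Fin n) (Fin n) ℝ) i j * (Real.exp (2 * σ u) * (2 * pderiv k σ u)) := by
  have hd : DifferentiableAt ℝ σ u := (hσ.differentiable (by simp)) u
  rw [pderiv_congr_fun (fun v => flatConformal_apply σ v i j),
    pderiv_const_mul (hd.const_mul 2).exp, pderiv_exp (hd.const_mul 2), pderiv_const_mul hd]

/-- The exponentials of the inverse metric and of its derivatives cancel, so the symbols are linear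
in dσ with constant coefficients and can be differentiated termwise. -/
theorem christoffel_flatConformal {σ : Coord n → ℝ} (hσ : ContDiff ℝ ∞ σ) (k i j : Fin n)
    (u : Coord n) : christoffel (flatConformal σ) k i j u =
      (1 : Matrix (Fin n) (Fin n) ℝ) k j * pderiv i σ u
        + (1 : Matrix (Fin n) (Fin n) ℝ) k i * pderiv j σ u
        - (1 : Matrix (Fin n) (Fin n) ℝ) i j * pderiv k σ u := by
  have he : Real.exp (-(2 * σ u)) * Real.exp (2 * σ u) = 1 := by
    rw [← Real.exp_add]; simp
  simp only [christoffel, flatConformal_inv, pderiv_flatConformal hσ, Matrix.smul_apply,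
    smul_eq_mul]
  rw [Finset.sum_eq_single k (fun l _ hl => by simp [Matrix.one_apply_ne hl.symm]) (by simp)]
  rw [Matrix.one_apply_eq]
  have h1 : (1 : Matrix (Fin n) (Fin n) ℝ) j k = (1 : Matrix (Fin n) (Fin n) ℝ) k j := by
    simp [Matrix.one_apply, eq_comm]
  have h2 : (1 : Matrix (Fin n) (Fin n) ℝ) i k = (1 : Matrix (Fin n) (Fin n) ℝ) k i := by
    simp [Matrix.one_apply, eq_comm]
  rw [h1, h2]
  linear_combination ((1 : Matrix (Fin n) (Fin n) ℝ) k j * pderiv i σ u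
        + (1 : Matrix (Fin n) (Fin n) ℝ) k i * pderiv j σ u
        - (1 : Matrix (Fin n) (Fin n) ℝ) i j * pderiv k σ u) * he

theorem pderiv_christoffel_flatConformal {σ : Coord n → ℝ} (hσ : ContDiff ℝ ∞ σ)
    (l k i j : Fin n) (u : Coord n) : pderiv l (christoffel (flatConformal σ) k i j) u =
      (1 : Matrix (Fin n) (Fin n) ℝ) k j * pderiv l (pderiv i σ) u
        + (1 : Matrix (Fin n) (Fin n) ℝ) k i * pderiv l (pderiv j σ) u
        - (1 : Matrix (Fin n) (Fin n) ℝ) i j * pderiv l (pderiv k σ) u := by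
  have hd (i : Fin n) : DifferentiableAt ℝ (pderiv i σ) u :=
    ((contDiff_pderiv hσ i).differentiable (by simp)) u
  rw [pderiv_congr_fun (christoffel_flatConformal hσ k i j),
    pderiv_sub (((hd i).const_mul _).fun_add ((hd j).const_mul _)) ((hd k).const_mul _),
    pderiv_add ((hd i).const_mul _) ((hd j).const_mul _), pderiv_const_mul (hd i),
    pderiv_const_mul (hd j), pderiv_const_mul (hd k)]

theorem pderiv_comm {f : Coord n → ℝ} (hf : ContDiff ℝ ∞ f) (i j : Fin n) (u : Coord n) :
    pderiv i (pderiv j f) u = pderiv j (pderiv i f) u := by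
  have hd : DifferentiableAt ℝ (fderiv ℝ f) u :=
    ((hf.fderiv_right (m := ∞) (by simp)).differentiable (by simp)) u
  have key (i j : Fin n) : pderiv i (pderiv j f) u =
      fderiv ℝ (fderiv ℝ f) u (EuclideanSpace.single i 1) (EuclideanSpace.single j 1) := by
    unfold pderiv
    rw [fderiv_clm_apply hd (by fun_prop)]
    simp
  rw [key, key]
  exact (hf.contDiffAt.isSymmSndFDerivAt (by simp; exact WithTop.coe_le_coe.2 le_top)) _ _

/-- Every Christoffel symbol is a sum of Kronecker deltas times ∂σ, so the sums over k and l
collapse; the factors n come from the traces of δ. -/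
theorem coordRicci_flatConformal {σ : Coord n → ℝ} (hσ : ContDiff ℝ ∞ σ) (i j : Fin n)
    (u : Coord n) : coordRicci (flatConformal σ) i j u =
      (2 - (n : ℝ)) * pderiv i (pderiv j σ) u
        - (1 : Matrix (Fin n) (Fin n) ℝ) i j * ∑ k, pderiv k (pderiv k σ) u
        + ((n : ℝ) - 2) * (pderiv i σ u * pderiv j σ u
          - (1 : Matrix (Fin n) (Fin n) ℝ) i j * ∑ k, pderiv k σ u * pderiv k σ u) := by
  have h1 : ∑ k, (pderiv k (christoffel (flatConformal σ) k i j) u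
      - pderiv j (christoffel (flatConformal σ) k i k) u) =
      (2 - (n : ℝ)) * pderiv i (pderiv j σ) u
        - (1 : Matrix (Fin n) (Fin n) ℝ) i j * ∑ k, pderiv k (pderiv k σ) u := by
    simp only [pderiv_christoffel_flatConformal hσ, Matrix.one_apply_eq]
    simp only [Matrix.one_apply, ite_mul, one_mul, zero_mul, Finset.sum_sub_distrib,
      Finset.sum_add_distrib, Finset.sum_ite_eq, Finset.sum_ite_eq', Finset.mem_univ, if_true,
      Finset.sum_const, Finset.card_univ, Fintype.card_fin, nsmul_eq_mul]
    rw [pderiv_comm hσ j i]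
    split_ifs <;> simp <;> ring
  have h2 : ∑ k, ∑ l, (christoffel (flatConformal σ) k k l u * christoffel (flatConformal σ) l i j u
        - christoffel (flatConformal σ) k j l u * christoffel (flatConformal σ) l i k u) =
      ((n : ℝ) - 2) * (pderiv i σ u * pderiv j σ u
          - (1 : Matrix (Fin n) (Fin n) ℝ) i j * ∑ k, pderiv k σ u * pderiv k σ u) := by
    simp only [christoffel_flatConformal hσ, Matrix.one_apply_eq]
    simp only [Matrix.one_apply, ite_mul, mul_ite, one_mul, zero_mul, mul_zero, add_mul, mul_add,
      sub_mul, mul_sub, Finset.sum_sub_distrib,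
      Finset.sum_add_distrib, Finset.sum_ite_eq, Finset.sum_ite_eq', Finset.mem_univ, if_true,
      Finset.sum_const, Finset.card_univ, Fintype.card_fin, nsmul_eq_mul]
    by_cases hij : i = j
    · subst hij
      simp [Finset.sum_add_distrib]
      ring
    · simp [hij, Ne.symm hij]
      ring
  rw [coordRicci, h1, h2]

theorem coordScalar_flatConformal {σ : Coord n → ℝ} (hσ : ContDiff ℝ ∞ σ) (u : Coord n) :
    coordScalar (flatConformal σ) u = Real.exp (-(2 * σ u)) * (((n : ℝ) - 1) *
      (-2 * (∑ k, pderiv k (pderiv k σ) u) - ((n : ℝ) - 2) * ∑ k, pderiv k σ u * pderiv k σ u)) := by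
  simp only [coordScalar, flatConformal_inv, coordRicci_flatConformal hσ, Matrix.smul_apply,
    smul_eq_mul]
  simp only [Matrix.one_apply, mul_ite, ite_mul, mul_one, mul_zero, zero_mul, Finset.sum_ite_eq,
    Finset.mem_univ, if_true, one_mul]
  rw [← Finset.mul_sum, Finset.sum_add_distrib, Finset.sum_sub_distrib, ← Finset.mul_sum,
    ← Finset.mul_sum, Finset.sum_sub_distrib]
  simp only [Finset.sum_const, Finset.card_univ, Fintype.card_fin, nsmul_eq_mul]
  ring

/-- The Schouten tensor of the conformally flat metric `e^{2σ} δ`. -/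
theorem coordSchouten_flatConformal (hn : 2 < n) {σ : Coord n → ℝ} (hσ : ContDiff ℝ ∞ σ)
    (i j : Fin n) (u : Coord n) : coordSchouten (flatConformal σ) i j u =
      -pderiv i (pderiv j σ) u + pderiv i σ u * pderiv j σ u
        - (1 / 2) * (∑ k, pderiv k σ u * pderiv k σ u) *
          (1 : Matrix (Fin n) (Fin n) ℝ) i j := by
  have h2 : (n : ℝ) - 2 ≠ 0 := by
    have : (2 : ℝ) < n := by exact_mod_cast hn
    linarith
  have h1 : (n : ℝ) - 1 ≠ 0 := by
    have : (2 : ℝ) < n := by exact_mod_cast hn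
    linarith
  have he : Real.exp (-(2 * σ u)) * Real.exp (2 * σ u) = 1 := by
    rw [← Real.exp_add]; simp
  rw [coordSchouten, coordScalar_flatConformal hσ, coordRicci_flatConformal hσ,
    flatConformal_apply]
  generalize Real.exp (-(2 * σ u)) = a at *
  -- The conformal factor of h cancels its inverse in S, and n - 1 cancels as well.
  have : ∀ A B d e : ℝ, a * e = 1 → a * (((n : ℝ) - 1) * A) / (2 * ((n : ℝ) - 1)) * (d * e)
      = A * d / 2 := by
    intro A B d e h
    field_simp
    linear_combination A * d * h
  rw [this _ 0 _ _ he]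
  field_simp
  ring

end ConformallyFlat
-- The preferred charts of the sphere as stereographic projections.
section Stereographic
variable {n : ℕ}

/-- The inverse of the stereographic projection of the unit sphere of `E` from `-x`, in coordinates
`U` of the hyperplane orthogonal to `x`. -/
noncomputable def stereoParam {E : Type*} [NormedAddCommGroup E] [InnerProductSpace ℝ E]
    (U : Coord n →ₗᵢ[ℝ] E) (x : E) (u : Coord n) : E :=
  -x + (‖u‖ ^ 2 + 4)⁻¹ • ((4 : ℝ) • U u + (8 : ℝ) • x)

/-- The preferred chart around x projects from -x and then identifies the hyperplane orthogonal to x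
with `ℝⁿ` isometrically. The inverse of this identification is `U`, whose range is exactly that
hyperplane. -/
theorem exists_chart_symm_eq_stereoParam (x : Sph n) :
    ∃ U : Coord n →ₗᵢ[ℝ] EuclideanSpace ℝ (Fin (n + 1)),
      (∀ w, ⟪U w, (x : EuclideanSpace ℝ (Fin (n + 1)))⟫_ℝ = 0) ∧
      (∀ y, ⟪y, (x : EuclideanSpace ℝ (Fin (n + 1)))⟫_ℝ = 0 → ∃ w, U w = y) ∧
      ∀ u, (((extChartAt (𝓡 n) x).symm u : Sph n) : EuclideanSpace ℝ (Fin (n + 1))) =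
        stereoParam U x u := by
  have := Fact.mk (@finrank_euclideanSpace_fin ℝ _ (n + 1))
  let V := (OrthonormalBasis.fromOrthogonalSpanSingleton (𝕜 := ℝ) n
    (ne_zero_of_mem_unit_sphere (-x))).repr
  refine ⟨(Submodule.subtypeₗᵢ _).comp V.symm.toLinearIsometry, fun w => ?_, fun y hy => ?_,
    fun u => ?_⟩
  · have := (V.symm w).2
    rw [Submodule.mem_orthogonal_singleton_iff_inner_left] at this
    simp only [Metric.sphere] at this
    have h2 : ⟪((V.symm w : _) : EuclideanSpace ℝ (Fin (n + 1))), -(x : EuclideanSpace ℝ (Fin (n + 1)))⟫_ℝ = 0 := this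
    rw [inner_neg_right, neg_eq_zero] at h2
    exact h2
  · have hy' : y ∈ (Submodule.span ℝ {((-x : Sph n) : EuclideanSpace ℝ (Fin (n + 1)))})ᗮ := by
      rw [Submodule.mem_orthogonal_singleton_iff_inner_left]
      simpa using hy
    exact ⟨V ⟨y, hy'⟩, congrArg Subtype.val (V.symm_apply_apply ⟨y, hy'⟩)⟩
  · have h1 : (extChartAt (𝓡 n) x).symm u = (stereographic' n (-x)).symm u := rfl
    have hn : ‖((V.symm u : _) : EuclideanSpace ℝ (Fin (n + 1)))‖ = ‖u‖ :=
      V.symm.norm_map u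
    rw [h1, stereographic'_symm_apply]
    simp only
    -- The pole term is rewritten by (s - 4) / (s + 4) = 1 - 8 / (s + 4), with s = ‖u‖².
    change (‖((V.symm u : _) : EuclideanSpace ℝ (Fin (n + 1)))‖ ^ 2 + 4)⁻¹ • (4 : ℝ) •
      ((V.symm u : _) : EuclideanSpace ℝ (Fin (n + 1))) +
      (‖((V.symm u : _) : EuclideanSpace ℝ (Fin (n + 1)))‖ ^ 2 + 4)⁻¹ •
      (‖((V.symm u : _) : EuclideanSpace ℝ (Fin (n + 1)))‖ ^ 2 - 4) •
        (-(x : EuclideanSpace ℝ (Fin (n + 1)))) = -(x : EuclideanSpace ℝ (Fin (n + 1))) +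
      (‖u‖ ^ 2 + 4)⁻¹ • ((4 : ℝ) • ((V.symm u : _) : EuclideanSpace ℝ (Fin (n + 1))) +
        (8 : ℝ) • (x : EuclideanSpace ℝ (Fin (n + 1))))
    rw [hn]
    have hq : ‖u‖ ^ 2 + 4 ≠ 0 := by positivity
    match_scalars <;> field_simp
    ring

/-- Only the pole is missing from the chart, so coordinate expressions are smooth on all of `ℝⁿ` and
no domain has to be tracked. -/
theorem extChartAt_sphere_target (x : Sph n) : (extChartAt (𝓡 n) x).target = Set.univ := by
  have := Fact.mk (@finrank_euclideanSpace_fin ℝ _ (n + 1))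
  rw [extChartAt_target]
  change (𝓡 n).symm ⁻¹' (stereographic' n (-x)).target ∩ _ = _
  simp

theorem extChartAt_sphere_self (x : Sph n) : extChartAt (𝓡 n) x x = 0 := by
  have := Fact.mk (@finrank_euclideanSpace_fin ℝ _ (n + 1))
  change stereographic' n (-x) x = 0
  change (OrthonormalBasis.fromOrthogonalSpanSingleton (𝕜 := ℝ) n
    (ne_zero_of_mem_unit_sphere (-x))).repr (stereographic (norm_eq_of_mem_sphere (-x)) x) = 0
  rw [show stereographic (norm_eq_of_mem_sphere (-x)) x = 0 from stereographic_neg_apply x,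
    map_zero]

theorem contMDiff_extChartAt_sphere_symm (x : Sph n) :
    ContMDiff 𝓘(ℝ, Coord n) (𝓡 n) ∞ (extChartAt (𝓡 n) x).symm := by
  have := contMDiffOn_extChartAt_symm (I := 𝓡 n) (n := ∞) x
  rwa [extChartAt_sphere_target, contMDiffOn_univ] at this

variable {F : Type*} [NormedAddCommGroup F] [NormedSpace ℝ F]

theorem contDiff_comp_extChartAt_symm {f : Sph n → F} (hf : ContMDiff (𝓡 n) 𝓘(ℝ, F) ∞ f)
    (x : Sph n) : ContDiff ℝ ∞ (f ∘ (extChartAt (𝓡 n) x).symm) :=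
  (hf.comp (contMDiff_extChartAt_sphere_symm x)).contDiff

theorem mvfderiv_mfderiv_extChartAt_symm {f : Sph n → F} (hf : ContMDiff (𝓡 n) 𝓘(ℝ, F) ∞ f)
    (x : Sph n) (u w : Coord n) :
    mvfderiv (𝓡 n) f ((extChartAt (𝓡 n) x).symm u)
      (mfderiv 𝓘(ℝ, Coord n) (𝓡 n) (extChartAt (𝓡 n) x).symm u w) =
      fderiv ℝ (f ∘ (extChartAt (𝓡 n) x).symm) u w := by
  rw [← mfderiv_eq_fderiv]
  exact (mfderiv_comp_apply (I := 𝓘(ℝ, Coord n)) (I' := 𝓡 n) (I'' := 𝓘(ℝ, F)) u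
    ((hf _).mdifferentiableAt (by simp))
    ((contMDiff_extChartAt_sphere_symm x u).mdifferentiableAt (by simp)) w).symm

/-- The coordinates of a tangent vector at `x` in the preferred chart around `x`. -/
noncomputable def chartVector (x : Sph n) (X : TangentSpace (𝓡 n) x) : Coord n :=
  mvfderiv (𝓡 n) (extChartAt (𝓡 n) x) x X

theorem mvfderiv_eq_fderiv_chart {f : Sph n → F} (hf : ContMDiff (𝓡 n) 𝓘(ℝ, F) ∞ f)
    (x : Sph n) (X : TangentSpace (𝓡 n) x) :
    mvfderiv (𝓡 n) f x X =
      fderiv ℝ (f ∘ (extChartAt (𝓡 n) x).symm) 0 (chartVector x X) := by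
  -- The identity holds only on the chart source, but a germ at x suffices for the derivative.
  have he : f =ᶠ[𝓝 x] (f ∘ (extChartAt (𝓡 n) x).symm) ∘ extChartAt (𝓡 n) x := by
    filter_upwards [extChartAt_source_mem_nhds (I := 𝓡 n) x] with y hy
    exact congrArg f ((extChartAt (𝓡 n) x).left_inv hy).symm
  have hd : DifferentiableAt ℝ (f ∘ (extChartAt (𝓡 n) x).symm) (extChartAt (𝓡 n) x x) :=
    (contDiff_comp_extChartAt_symm hf x).differentiable (by simp) _
  have hc := mfderiv_comp_apply (I := 𝓡 n) (I' := 𝓘(ℝ, Coord n)) (I'' := 𝓘(ℝ, F)) x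
    hd.mdifferentiableAt (mdifferentiableAt_extChartAt (mem_chart_source _ x)) X
  rw [← he.mfderiv_eq, mfderiv_eq_fderiv] at hc
  rw [← extChartAt_sphere_self x]
  exact hc

end Stereographic
-- First and second derivatives of the stereographic parametrization.
section Stereographic
variable {n : ℕ} {E : Type*} [NormedAddCommGroup E] [InnerProductSpace ℝ E]

theorem hasFDerivAt_inv_norm_sq_add_four (u : Coord n) :
    HasFDerivAt (fun v : Coord n => (‖v‖ ^ 2 + 4)⁻¹)
      ((-((‖u‖ ^ 2 + 4) ^ 2)⁻¹) • (2 : ℝ) • innerSL ℝ u) u := by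
  have hq : ‖u‖ ^ 2 + 4 ≠ 0 := by positivity
  have h : HasFDerivAt (fun v : Coord n => ‖v‖ ^ 2 + 4) ((2 : ℝ) • innerSL ℝ u) u :=
    ((hasStrictFDerivAt_norm_sq u).hasFDerivAt.add_const 4).congr_fderiv
      ((two_smul ℕ _).trans (two_smul ℝ _).symm)
  exact (hasDerivAt_inv hq).comp_hasFDerivAt u h

theorem contDiff_stereoParam (U : Coord n →ₗᵢ[ℝ] E) (x : E) : ContDiff ℝ ∞ (stereoParam U x) := by
  have hU : ContDiff ℝ ∞ (fun u => U u) := U.contDiff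
  have h : ContDiff ℝ ∞ (fun v : Coord n => (‖v‖ ^ 2 + 4)⁻¹) :=
    ((contDiff_norm_sq ℝ).add contDiff_const).inv fun v => by positivity
  exact contDiff_const.add (h.smul ((hU.const_smul _).add contDiff_const))

theorem fderiv_stereoParam (U : Coord n →ₗᵢ[ℝ] E) (x : E) (u w : Coord n) :
    fderiv ℝ (stereoParam U x) u w =
      (-((‖u‖ ^ 2 + 4) ^ 2)⁻¹ * (2 * ⟪u, w⟫_ℝ)) • ((4 : ℝ) • U u + (8 : ℝ) • x)
        + (‖u‖ ^ 2 + 4)⁻¹ • (4 : ℝ) • U w := by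
  have hU : HasFDerivAt (fun u => (4 : ℝ) • U u + (8 : ℝ) • x)
      ((4 : ℝ) • U.toContinuousLinearMap) u :=
    (U.toContinuousLinearMap.hasFDerivAt.const_smul (4 : ℝ)).add_const _
  have h := ((hasFDerivAt_inv_norm_sq_add_four u).smul hU).const_add (-x)
  have h' : fderiv ℝ (stereoParam U x) u = _ := h.fderiv
  rw [h']
  simp [add_comm]

theorem stereoParam_zero (U : Coord n →ₗᵢ[ℝ] E) (x : E) : stereoParam U x 0 = x := by
  simp only [stereoParam, norm_zero, map_zero]
  match_scalars
  norm_num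

theorem fderiv_stereoParam_zero (U : Coord n →ₗᵢ[ℝ] E) (x : E) (w : Coord n) :
    fderiv ℝ (stereoParam U x) 0 w = U w := by
  rw [fderiv_stereoParam]
  simp

/-- At the centre of the chart the second derivative of the sphere is `-⟪w, z⟫ x`. -/
theorem fderiv_fderiv_stereoParam_zero (U : Coord n →ₗᵢ[ℝ] E) (x : E) (w z : Coord n) :
    fderiv ℝ (fun u => fderiv ℝ (stereoParam U x) u w) 0 z = -(⟪z, w⟫_ℝ • x) := by
  simp only [fderiv_stereoParam]
  have hq := hasFDerivAt_inv_norm_sq_add_four (0 : Coord n)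
  have hU : HasFDerivAt (fun u => (4 : ℝ) • U u + (8 : ℝ) • x)
      ((4 : ℝ) • U.toContinuousLinearMap) 0 :=
    (U.toContinuousLinearMap.hasFDerivAt.const_smul (4 : ℝ)).add_const _
  have hi : HasFDerivAt (fun u : Coord n => (2 : ℝ) * ⟪u, w⟫_ℝ) ((2 : ℝ) • innerSL ℝ w) 0 := by
    have := ((innerSL ℝ w).hasFDerivAt (x := (0 : Coord n))).const_mul (2 : ℝ)
    simpa [real_inner_comm] using this
  have h1 : HasFDerivAt (fun u : Coord n => -((‖u‖ ^ 2 + 4) ^ 2)⁻¹) (0 : Coord n →L[ℝ] ℝ) 0 := by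
    have h2 : HasFDerivAt (fun u : Coord n => -((‖u‖ ^ 2 + 4)⁻¹ ^ 2)) (0 : Coord n →L[ℝ] ℝ) 0 :=
      (hq.pow 2).fun_neg.congr_fderiv (by simp)
    simpa only [inv_pow] using h2
  -- At 0 the radial factors are critical and ⟪u, w⟫ vanishes, so only its derivative survives:
  -- -(1/16) · 2⟪z, w⟫ · 8x.
  have h := ((h1.fun_mul hi).fun_smul hU).fun_add (hq.smul_const ((4 : ℝ) • U w))
  rw [h.fderiv]
  simp [smul_smul, real_inner_comm]
  norm_num
  congr 1
  ring

/-- Stereographic projection is conformal: since ‖4 U u + 8 x‖² = 16 (‖u‖² + 4), the terms in ⟪u,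
a⟫⟪u, b⟫ cancel. -/
theorem inner_fderiv_stereoParam (U : Coord n →ₗᵢ[ℝ] E) {x : E} (hx : ‖x‖ = 1)
    (hU : ∀ w, ⟪U w, x⟫_ℝ = 0) (u a b : Coord n) :
    ⟪fderiv ℝ (stereoParam U x) u a, fderiv ℝ (stereoParam U x) u b⟫_ℝ =
      16 * ((‖u‖ ^ 2 + 4) ^ 2)⁻¹ * ⟪a, b⟫_ℝ := by
  have hU' : ∀ w, ⟪x, U w⟫_ℝ = 0 := fun w => by rw [real_inner_comm, hU]
  have hxx : ⟪x, x⟫_ℝ = 1 := by rw [real_inner_self_eq_norm_sq, hx]; norm_num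
  have hq : ‖u‖ ^ 2 + 4 ≠ 0 := by positivity
  rw [fderiv_stereoParam, fderiv_stereoParam]
  simp only [inner_add_left, inner_add_right, real_inner_smul_left, real_inner_smul_right, hU, hU',
    hxx, U.inner_map_map, real_inner_self_eq_norm_sq u, real_inner_comm u a]
  generalize ‖u‖ ^ 2 = s at *
  field_simp
  ring

/-- Expansion of the inner product with respect to a unit vector `x` and an orthonormal basis of
its orthogonal complement. -/
theorem inner_eq_sum_of_orthogonal (U : Coord n →ₗᵢ[ℝ] E) {x : E} (hx : ‖x‖ = 1)
    (hU : ∀ w, ⟪U w, x⟫_ℝ = 0) (hs : ∀ y, ⟪y, x⟫_ℝ = 0 → ∃ w, U w = y)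
    (b : OrthonormalBasis (Fin n) ℝ (Coord n)) (y z : E) :
    ⟪y, z⟫_ℝ = ⟪y, x⟫_ℝ * ⟪z, x⟫_ℝ + ∑ k, ⟪y, U (b k)⟫_ℝ * ⟪z, U (b k)⟫_ℝ := by
  have hU' : ∀ w, ⟪x, U w⟫_ℝ = 0 := fun w => by rw [real_inner_comm, hU]
  have hxx : ⟪x, x⟫_ℝ = 1 := by rw [real_inner_self_eq_norm_sq, hx]; norm_num
  have dec : ∀ y : E, ∃ w, y = ⟪y, x⟫_ℝ • x + U w := fun y => by
    obtain ⟨w, hw⟩ := hs (y - ⟪y, x⟫_ℝ • x) (by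
      rw [inner_sub_left, real_inner_smul_left, hxx]; ring)
    exact ⟨w, by rw [hw]; abel⟩
  obtain ⟨w, hw⟩ := dec y
  obtain ⟨v, hv⟩ := dec z
  have hyw : ∀ a, ⟪y, U a⟫_ℝ = ⟪w, a⟫_ℝ := fun a => by
    rw [hw, inner_add_left, real_inner_smul_left, hU', U.inner_map_map]; ring
  have hzv : ∀ a, ⟪z, U a⟫_ℝ = ⟪v, a⟫_ℝ := fun a => by
    rw [hv, inner_add_left, real_inner_smul_left, hU', U.inner_map_map]; ring
  simp only [hyw, hzv]
  have : ∑ k, ⟪w, b k⟫_ℝ * ⟪v, b k⟫_ℝ = ⟪w, v⟫_ℝ := by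
    rw [← b.sum_inner_mul_inner w v]
    exact Finset.sum_congr rfl fun k _ => by rw [real_inner_comm v]
  rw [this, ← hyw v]
  calc ⟪y, z⟫_ℝ = ⟪y, ⟪z, x⟫_ℝ • x + U v⟫_ℝ := by rw [← hv]
    _ = _ := by rw [inner_add_right, real_inner_smul_right, mul_comm]

end Stereographic
-- The conformal Gauss equation, and the conformal factor of the sphere.
section Stereographic
variable {n : ℕ} {E : Type*} [NormedAddCommGroup E] [InnerProductSpace ℝ E]

/-- This is the derivative of `h2`, where `h3` removes the terms in which (a, y) is differentiated.
-/
theorem inner_fderiv_stereoParam_eq (U : Coord n →ₗᵢ[ℝ] E) (x : E) {a r : Coord n → ℝ}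
    {y : Coord n → E} (ha : ContDiff ℝ ∞ a) (hr : ContDiff ℝ ∞ r) (hy : ContDiff ℝ ∞ y)
    (h2 : ∀ u, -a u + ⟪y u, stereoParam U x u⟫_ℝ = -Real.exp (-r u))
    (h3 : ∀ u w, -fderiv ℝ a u w + ⟪fderiv ℝ y u w, stereoParam U x u⟫_ℝ = 0) (u w : Coord n) :
    ⟪y u, fderiv ℝ (stereoParam U x) u w⟫_ℝ = Real.exp (-r u) * fderiv ℝ r u w := by
  have da := (ha.differentiable (by simp) u).hasFDerivAt
  have dr := (hr.differentiable (by simp) u).hasFDerivAt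
  have dy := (hy.differentiable (by simp) u).hasFDerivAt
  have dP := ((contDiff_stereoParam U x).differentiable (by simp) u).hasFDerivAt
  have hl := da.fun_neg.fun_add (dy.inner ℝ dP)
  rw [funext h2] at hl
  have he := congrArg (fun L => L w) (hl.unique dr.fun_neg.exp.fun_neg)
  simp [fderivInnerCLM_apply] at he
  linarith [h3 u w]

/-- The conformal Gauss equation: if `(a, y)` is a hypersurface of hyperbolic space whose light
cone map is `e^r (1, P)` with `P` the stereographic parametrization of the sphere, then
`⟨D(a, y), D(e^r (1, P))⟩` at the centre of the chart is determined by `r`. -/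
theorem exp_mul_inner_fderiv (U : Coord n →ₗᵢ[ℝ] E) {x : E} (hx : ‖x‖ = 1)
    (hU : ∀ w, ⟪U w, x⟫_ℝ = 0) (hs : ∀ y, ⟪y, x⟫_ℝ = 0 → ∃ w, U w = y) {a r : Coord n → ℝ}
    {y : Coord n → E} (ha : ContDiff ℝ ∞ a) (hr : ContDiff ℝ ∞ r) (hy : ContDiff ℝ ∞ y)
    (h1 : ∀ u, -(a u * a u) + ⟪y u, y u⟫_ℝ = -1)
    (h2 : ∀ u, -a u + ⟪y u, stereoParam U x u⟫_ℝ = -Real.exp (-r u))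
    (h3 : ∀ u w, -fderiv ℝ a u w + ⟪fderiv ℝ y u w, stereoParam U x u⟫_ℝ = 0) (z w : Coord n) :
    Real.exp (r 0) * ⟪fderiv ℝ y 0 z, U w⟫_ℝ =
      fderiv ℝ (fun u => fderiv ℝ r u w) 0 z - fderiv ℝ r 0 z * fderiv ℝ r 0 w
        + (1 / 2) * (Real.exp (2 * r 0) - 1 + ∑ k, pderiv k r 0 * pderiv k r 0) * ⟪z, w⟫_ℝ := by
  have key := inner_fderiv_stereoParam_eq U x ha hr hy h2 h3
  have dr := (hr.differentiable (by simp) 0).hasFDerivAt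
  have dy := (hy.differentiable (by simp) 0).hasFDerivAt
  have dP : HasFDerivAt (fun u => fderiv ℝ (stereoParam U x) u w) _ 0 :=
    ((((contDiff_stereoParam U x).fderiv_right (m := ∞) (by simp)).clm_apply
      contDiff_const).differentiable (by simp) 0).hasFDerivAt
  have drr : HasFDerivAt (fun u => fderiv ℝ r u w) _ 0 :=
    (((hr.fderiv_right (m := ∞) (by simp)).clm_apply
      contDiff_const).differentiable (by simp) 0).hasFDerivAt
  -- Differentiating `key` at the centre gives the wanted pairing, plus a term in ⟪y 0, x⟫ from the
  -- second derivative of the sphere.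
  have hl := dy.inner ℝ dP
  rw [funext fun u => key u w] at hl
  have he := congrArg (fun L => L z) (hl.unique (dr.fun_neg.exp.fun_mul drr))
  simp only [fderivInnerCLM_apply, ContinuousLinearMap.comp_apply, ContinuousLinearMap.prod_apply,
    fderiv_fderiv_stereoParam_zero, fderiv_stereoParam_zero, inner_neg_right,
    real_inner_smul_right, add_apply, smul_apply,
    neg_apply, smul_eq_mul] at he
  have hnorm := inner_eq_sum_of_orthogonal U hx hU hs (EuclideanSpace.basisFun (Fin n) ℝ)
    (y 0) (y 0)
  have hsum : ∑ k, ⟪y 0, U (EuclideanSpace.basisFun (Fin n) ℝ k)⟫_ℝ *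
      ⟪y 0, U (EuclideanSpace.basisFun (Fin n) ℝ k)⟫_ℝ =
      Real.exp (-r 0) ^ 2 * ∑ k, pderiv k r 0 * pderiv k r 0 := by
    rw [Finset.mul_sum]
    refine Finset.sum_congr rfl fun k _ => ?_
    rw [← fderiv_stereoParam_zero U x, key]
    simp only [EuclideanSpace.basisFun_apply, pderiv]
    ring
  rw [hsum] at hnorm
  have h20 := h2 0
  have h10 := h1 0
  rw [stereoParam_zero] at h20
  generalize ∑ k, pderiv k r 0 * pderiv k r 0 = S at *
  have hee : Real.exp (r 0) * Real.exp (-r 0) = 1 := by rw [← Real.exp_add]; simp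
  have he2 : Real.exp (2 * r 0) = Real.exp (r 0) ^ 2 := by rw [two_mul, Real.exp_add, sq]
  rw [he2]
  generalize Real.exp (r 0) = p at *
  generalize Real.exp (-r 0) = q at *
  -- With s = ⟪y 0, x⟫ the equation ⟨φ, φ⟩ = -1 reads -(s + q)² + s² + q² S = -1. The s² cancel, so
  -- it is linear in s, and p q = 1 gives p s.
  rw [show a 0 = ⟪y 0, x⟫_ℝ + q by linarith, hnorm] at h10
  have hps : p * ⟪y 0, x⟫_ℝ = (1 / 2) * (p ^ 2 - 1 + S) := by
    generalize ⟪y 0, x⟫_ℝ = s at *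
    have e1 : 2 * s * q = 1 - q ^ 2 + q ^ 2 * S := by linarith
    have e2 : p ^ 2 * q = p := by linear_combination p * hee
    linear_combination (p ^ 2 / 2) * e1 - s * e2 + ((1 / 2) * (p * q + 1) * (S - 1)) * hee
  linear_combination p * he + ⟪z, w⟫_ℝ * hps +
    (fderiv ℝ (fun u => fderiv ℝ r u w) 0 z - fderiv ℝ r 0 z * fderiv ℝ r 0 w) * hee

/-- The logarithm of the conformal factor of the sphere in stereographic coordinates. -/
noncomputable def stereoFactor (u : Coord n) : ℝ := Real.log (4 * (‖u‖ ^ 2 + 4)⁻¹)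

theorem contDiff_stereoFactor : ContDiff ℝ ∞ (stereoFactor (n := n)) := by
  have h : ContDiff ℝ ∞ (fun v : Coord n => (‖v‖ ^ 2 + 4)⁻¹) :=
    ((contDiff_norm_sq ℝ).add contDiff_const).inv fun v => by positivity
  exact (contDiff_const.mul h).log fun v => by positivity

theorem exp_two_mul_stereoFactor (u : Coord n) :
    Real.exp (2 * stereoFactor u) = 16 * ((‖u‖ ^ 2 + 4) ^ 2)⁻¹ := by
  rw [two_mul, Real.exp_add, stereoFactor, Real.exp_log (by positivity)]
  field_simp
  norm_num

theorem pderiv_stereoFactor (i : Fin n) (u : Coord n) :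
    pderiv i stereoFactor u = -2 * (‖u‖ ^ 2 + 4)⁻¹ * u i := by
  have hq : ‖u‖ ^ 2 + 4 ≠ 0 := by positivity
  have h := ((hasFDerivAt_inv_norm_sq_add_four u).const_mul 4).log (by positivity)
  rw [pderiv]
  unfold stereoFactor
  rw [h.fderiv]
  simp [EuclideanSpace.inner_single_right]
  field_simp


theorem pderiv_stereoFactor_zero (i : Fin n) : pderiv i stereoFactor (0 : Coord n) = 0 := by
  simp [pderiv_stereoFactor]

/-- The value -½ δ is the source of the curvature term ½ g₀ in the Schouten formula. -/
theorem pderiv_pderiv_stereoFactor_zero (i j : Fin n) :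
    pderiv i (pderiv j stereoFactor) (0 : Coord n) =
      -(1 / 2) * (1 : Matrix (Fin n) (Fin n) ℝ) i j := by
  have hj : HasFDerivAt (fun u : Coord n => u j)
      (EuclideanSpace.proj j : Coord n →L[ℝ] ℝ) 0 :=
    (EuclideanSpace.proj j : Coord n →L[ℝ] ℝ).hasFDerivAt
  have h := ((hasFDerivAt_inv_norm_sq_add_four (0 : Coord n)).const_mul (-2)).fun_mul hj
  rw [pderiv, funext (pderiv_stereoFactor j), h.fderiv]
  simp [Matrix.one_apply, eq_comm]
  split_ifs <;> norm_num
end Stereographic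
-- The Hessian, gradient and Schouten tensor on the round sphere.
section Sphere
variable {n : ℕ}

theorem contMDiff_sphere_coe :
    ContMDiff (𝓡 n) 𝓘(ℝ, EuclideanSpace ℝ (Fin (n + 1))) ∞
      ((↑) : Sph n → EuclideanSpace ℝ (Fin (n + 1))) := by
  have := Fact.mk (@finrank_euclideanSpace_fin ℝ _ (n + 1))
  exact contMDiff_coe_sphere

/-- By conformality and homogeneity the matrix is the same in all preferred charts, whatever x and
`U`. -/
theorem chartMatrix_roundMetric (x : Sph n) :
    chartMatrix (roundMetric n) x = flatConformal stereoFactor := by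
  obtain ⟨U, hU, -, hP⟩ := exists_chart_symm_eq_stereoParam x
  have hP' : ((↑) : Sph n → EuclideanSpace ℝ (Fin (n + 1))) ∘ (extChartAt (𝓡 n) x).symm =
      stereoParam U x := funext hP
  ext u i j
  simp only [chartMatrix, roundMetric, Matrix.of_apply,
    mvfderiv_mfderiv_extChartAt_symm contMDiff_sphere_coe, hP']
  rw [inner_fderiv_stereoParam U (norm_eq_of_mem_sphere x) hU, flatConformal_apply,
    exp_two_mul_stereoFactor, mul_comm]
  simp [EuclideanSpace.inner_single_left, Matrix.one_apply]

theorem chartMatrix_conformalMetric (ρ : Sph n → ℝ) (x : Sph n) :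
    chartMatrix (conformalMetric ρ) x =
      flatConformal fun u => (ρ ∘ (extChartAt (𝓡 n) x).symm) u + stereoFactor u := by
  have h := chartMatrix_roundMetric x
  ext u i j
  have hij := congrFun (congrFun (congrFun h u) i) j
  simp only [chartMatrix, conformalMetric, Matrix.of_apply] at hij ⊢
  rw [hij, flatConformal_apply, flatConformal_apply, mul_add, Real.exp_add]
  simp only [Function.comp_apply]
  ring

/-- At the centre the parametrization has the isometry `U` as its derivative. -/
theorem roundMetric_eq_inner (x : Sph n) (X Y : TangentSpace (𝓡 n) x) :
    roundMetric n x X Y = ⟪chartVector x X, chartVector x Y⟫_ℝ := by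
  obtain ⟨U, hU, -, hP⟩ := exists_chart_symm_eq_stereoParam x
  have hP' : ((↑) : Sph n → EuclideanSpace ℝ (Fin (n + 1))) ∘ (extChartAt (𝓡 n) x).symm =
      stereoParam U x := funext hP
  rw [roundMetric, mvfderiv_eq_fderiv_chart contMDiff_sphere_coe,
    mvfderiv_eq_fderiv_chart contMDiff_sphere_coe, hP', fderiv_stereoParam_zero,
    fderiv_stereoParam_zero, U.inner_map_map]

theorem linear_eq_sum_single (L : Coord n →L[ℝ] ℝ) (w : Coord n) :
    L w = ∑ i, w i * L (EuclideanSpace.single i 1) := by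
  conv_lhs => rw [← (EuclideanSpace.basisFun (Fin n) ℝ).sum_repr w]
  simp

theorem ofChartMatrix_mul (x : Sph n) (L L' : Coord n →L[ℝ] ℝ) (X Y : TangentSpace (𝓡 n) x) :
    ofChartMatrix x (fun i j => L (EuclideanSpace.single i 1) * L' (EuclideanSpace.single j 1)) X Y
      = L (chartVector x X) * L' (chartVector x Y) := by
  rw [linear_eq_sum_single L, linear_eq_sum_single L', Finset.sum_mul_sum]
  refine Finset.sum_congr rfl fun i _ => Finset.sum_congr rfl fun j _ => ?_
  change _ * (chartVector x X i * chartVector x Y j) = _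
  ring

theorem ofChartMatrix_one (x : Sph n) (X Y : TangentSpace (𝓡 n) x) :
    ofChartMatrix x (fun i j => (1 : Matrix (Fin n) (Fin n) ℝ) i j) X Y =
      ⟪chartVector x X, chartVector x Y⟫_ℝ := by
  rw [PiLp.inner_apply]
  refine Finset.sum_congr rfl fun i _ => ?_
  rw [Finset.sum_eq_single i (fun j _ hj => by simp [Matrix.one_apply_ne hj.symm]) (by simp)]
  simp only [Matrix.one_apply_eq, one_mul]
  exact mul_comm (chartVector x X i) (chartVector x Y i)

theorem ofChartMatrix_pderiv_pderiv {r : Coord n → ℝ} (hr : ContDiff ℝ ∞ r) (x : Sph n)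
    (X Y : TangentSpace (𝓡 n) x) :
    ofChartMatrix x (fun i j => pderiv i (pderiv j r) 0) X Y =
      fderiv ℝ (fun u => fderiv ℝ r u (chartVector x Y)) 0 (chartVector x X) := by
  have hd (w : Coord n) : DifferentiableAt ℝ (fun u => fderiv ℝ r u w) 0 :=
    ((hr.fderiv_right (m := ∞) (by simp)).clm_apply contDiff_const).differentiable (by simp) 0
  have h1 : (fun u => fderiv ℝ r u (chartVector x Y)) =
      fun u => ∑ j, chartVector x Y j * fderiv ℝ r u (EuclideanSpace.single j 1) :=
    funext fun u => linear_eq_sum_single _ _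
  have h2 : HasFDerivAt
      (fun u => ∑ j, chartVector x Y j * fderiv ℝ r u (EuclideanSpace.single j 1)) _ 0 :=
    HasFDerivAt.fun_sum fun j _ => (hd (EuclideanSpace.single j 1)).hasFDerivAt.const_mul _
  rw [h1, h2.fderiv, linear_eq_sum_single]
  refine Finset.sum_congr rfl fun i _ => ?_
  rw [sum_apply, Finset.mul_sum]
  refine Finset.sum_congr rfl fun j _ => ?_
  change _ * (chartVector x X i * chartVector x Y j) = _
  simp only [smul_apply, smul_eq_mul]
  change pderiv i (pderiv j r) 0 * _ = chartVector x X i * (_ * pderiv i (pderiv j r) 0)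
  ring

theorem stereoFactor_zero : stereoFactor (0 : Coord n) = 0 := by
  simp [stereoFactor]

variable {ρ : Sph n → ℝ}

/-- `stereoFactor` is critical at the centre, so the Christoffel symbols of g₀ vanish there. -/
theorem hessian_roundMetric (hρ : ContMDiff (𝓡 n) 𝓘(ℝ) ∞ ρ) (x : Sph n)
    (X Y : TangentSpace (𝓡 n) x) : hessian (roundMetric n) ρ x X Y =
      fderiv ℝ (fun u => fderiv ℝ (ρ ∘ (extChartAt (𝓡 n) x).symm) u (chartVector x Y)) 0
        (chartVector x X) := by
  rw [← ofChartMatrix_pderiv_pderiv (contDiff_comp_extChartAt_symm hρ x)]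
  unfold hessian
  congr 1
  ext i j
  rw [chartMatrix_roundMetric, extChartAt_sphere_self, coordHessian]
  simp [christoffel_flatConformal contDiff_stereoFactor, pderiv_stereoFactor_zero]

theorem gradNormSq_roundMetric (x : Sph n) : gradNormSq (roundMetric n) ρ x =
    ∑ k, pderiv k (ρ ∘ (extChartAt (𝓡 n) x).symm) 0 *
      pderiv k (ρ ∘ (extChartAt (𝓡 n) x).symm) 0 := by
  rw [gradNormSq, chartMatrix_roundMetric, extChartAt_sphere_self, coordGradNormSq]
  simp [flatConformal_inv, stereoFactor_zero, Matrix.one_apply]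

theorem conformalSchoutenFormula_eq (hρ : ContMDiff (𝓡 n) 𝓘(ℝ) ∞ ρ) (x : Sph n)
    (X Y : TangentSpace (𝓡 n) x) : conformalSchoutenFormula ρ x X Y =
      -fderiv ℝ (fun u => fderiv ℝ (ρ ∘ (extChartAt (𝓡 n) x).symm) u (chartVector x Y)) 0
        (chartVector x X)
      + fderiv ℝ (ρ ∘ (extChartAt (𝓡 n) x).symm) 0 (chartVector x X) *
        fderiv ℝ (ρ ∘ (extChartAt (𝓡 n) x).symm) 0 (chartVector x Y)
      - (1 / 2) * (-1 + ∑ k, pderiv k (ρ ∘ (extChartAt (𝓡 n) x).symm) 0 *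
        pderiv k (ρ ∘ (extChartAt (𝓡 n) x).symm) 0) *
        ⟪chartVector x X, chartVector x Y⟫_ℝ := by
  rw [conformalSchoutenFormula, hessian_roundMetric hρ, gradNormSq_roundMetric,
    roundMetric_eq_inner, mvfderiv_eq_fderiv_chart hρ, mvfderiv_eq_fderiv_chart hρ]

/-- The conformal change of the Schouten tensor of the round sphere. -/
theorem schouten_eq_conformalSchoutenFormula (hρ : ContMDiff (𝓡 n) 𝓘(ℝ) ∞ ρ) :
    schouten ρ = conformalSchoutenFormula ρ := by
  by_cases hn : 2 < n
  swap
  -- Outside n > 2 the tensor is the formula by definition.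
  · simp [schouten, hn]
  rw [schouten, if_pos hn]
  funext x X Y
  rw [conformalSchoutenFormula_eq hρ]
  have hr := contDiff_comp_extChartAt_symm hρ x
  rw [schoutenTensor, chartMatrix_conformalMetric, extChartAt_sphere_self]
  generalize ρ ∘ (extChartAt (𝓡 n) x).symm = r at *
  have hd : Differentiable ℝ r := hr.differentiable (by simp)
  have hτ : Differentiable ℝ (stereoFactor (n := n)) :=
    contDiff_stereoFactor.differentiable (by simp)
  have h1 (i : Fin n) (u : Coord n) : pderiv i (fun v => r v + stereoFactor v) u =
      pderiv i r u + pderiv i stereoFactor u := pderiv_add (hd u) (hτ u) i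
  have h2 (i j : Fin n) : pderiv i (pderiv j fun v => r v + stereoFactor v) 0 =
      pderiv i (pderiv j r) 0 - (1 / 2) * (1 : Matrix (Fin n) (Fin n) ℝ) i j := by
    rw [pderiv_congr_fun (h1 j), pderiv_add ((contDiff_pderiv hr j).differentiable (by simp) 0)
      ((contDiff_pderiv contDiff_stereoFactor j).differentiable (by simp) 0),
      pderiv_pderiv_stereoFactor_zero]
    ring
  simp only [coordSchouten_flatConformal hn (hr.add contDiff_stereoFactor), h1, h2,
    pderiv_stereoFactor_zero, add_zero]
  -- Both sides become double sums over the chart components, to be compared coefficient by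
  -- coefficient.
  rw [← ofChartMatrix_pderiv_pderiv hr, ← ofChartMatrix_mul x (fderiv ℝ r 0) (fderiv ℝ r 0),
    ← ofChartMatrix_one]
  simp only [ofChartMatrix, Finset.mul_sum (Finset.univ : Finset (Fin n)),
    ← Finset.sum_neg_distrib, ← Finset.sum_add_distrib, ← Finset.sum_sub_distrib]
  refine Finset.sum_congr rfl fun i _ => Finset.sum_congr rfl fun j _ => ?_
  simp only [pderiv, ← Finset.mul_sum]
  ring

end Sphere
-- The light cone map of a hypersurface with the identity as hyperbolic Gauss map.
section GaussMap
variable {n : ℕ} {φ η : Sph n → Minkowski n}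

theorem lorentz_add_left (v w z : Minkowski n) :
    lorentz (v + w) z = lorentz v z + lorentz w z := by
  simp only [lorentz, Prod.fst_add, Prod.snd_add, inner_add_left]
  ring

theorem lorentz_add_right (v w z : Minkowski n) :
    lorentz v (w + z) = lorentz v w + lorentz v z := by
  simp only [lorentz, Prod.fst_add, Prod.snd_add, inner_add_right]
  ring

theorem lorentz_comm (v w : Minkowski n) : lorentz v w = lorentz w v := by
  rw [lorentz, lorentz, real_inner_comm, mul_comm]

/-- A point of hyperbolic space pairs negatively only with future directed null vectors. -/
theorem fst_pos_of_lorentz {y v : Minkowski n} (hy : y ∈ hyperbolicSpace n)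
    (hv : lorentz v v = 0) (hyv : lorentz y v = -1) : 0 < v.1 := by
  obtain ⟨hy, hy0⟩ := hy
  simp only [lorentz, real_inner_self_eq_norm_sq] at hy hv hyv
  have hle : ‖y.2‖ ≤ y.1 := by
    apply le_of_sq_le_sq _ hy0.le
    nlinarith
  have hab := abs_real_inner_le_norm y.2 v.2
  have hvn : ‖v.2‖ = |v.1| := by
    rw [← abs_of_nonneg (norm_nonneg v.2)]
    exact (sq_eq_sq_iff_abs_eq_abs _ _).1 (by linarith)
  -- If v.1 ≤ 0, Cauchy–Schwarz gives ⟨y, v⟩ ≥ (‖y.2‖ - y.1) v.1 ≥ 0, against ⟨y, v⟩ = -1.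
  by_contra hneg
  rw [hvn, abs_of_nonpos (not_lt.1 hneg)] at hab
  have := (abs_le.1 hab).1
  nlinarith

theorem lorentz_lightConeMap_self (hη : IsUnitNormal φ η) (hφ : IsImmersedHypersurface φ)
    (x : Sph n) : lorentz (lightConeMap φ η x) (lightConeMap φ η x) = 0 := by
  simp only [lightConeMap, lorentz_add_left, lorentz_add_right, hη.unit, hη.tangent,
    lorentz_comm (φ x) (η x), (hφ.mem_hyperbolicSpace x).1]
  norm_num

theorem lorentz_lightConeMap (hη : IsUnitNormal φ η) (hφ : IsImmersedHypersurface φ)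
    (x : Sph n) : lorentz (φ x) (lightConeMap φ η x) = -1 := by
  rw [lightConeMap, lorentz_add_right, (hφ.mem_hyperbolicSpace x).1, lorentz_comm, hη.tangent]
  norm_num

theorem lightConeMap_fst_pos (hη : IsUnitNormal φ η) (hφ : IsImmersedHypersurface φ)
    (x : Sph n) : 0 < (lightConeMap φ η x).1 :=
  fst_pos_of_lorentz (hφ.mem_hyperbolicSpace x) (lorentz_lightConeMap_self hη hφ x)
    (lorentz_lightConeMap hη hφ x)

theorem contMDiff_lightConeMap (hη : IsUnitNormal φ η) (hφ : IsImmersedHypersurface φ) :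
    ContMDiff (𝓡 n) 𝓘(ℝ, Minkowski n) ∞ (lightConeMap φ η) :=
  hφ.smooth.add hη.smooth

theorem contMDiff_logSupport (hη : IsUnitNormal φ η) (hφ : IsImmersedHypersurface φ) :
    ContMDiff (𝓡 n) 𝓘(ℝ) ∞ (logSupport φ η) := by
  intro x
  have h1 : ContMDiffAt (𝓡 n) 𝓘(ℝ) ∞ (fun x => (lightConeMap φ η x).1) x :=
    (contDiff_fst (𝕜 := ℝ) (E := ℝ) (F := EuclideanSpace ℝ (Fin (n + 1)))).contMDiff.contMDiffAt.comp
      x (contMDiff_lightConeMap hη hφ x)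
  exact (Real.contDiffAt_log.2 (lightConeMap_fst_pos hη hφ x).ne').contMDiffAt.comp x h1

theorem exp_logSupport (hη : IsUnitNormal φ η) (hφ : IsImmersedHypersurface φ) (x : Sph n) :
    Real.exp (logSupport φ η x) = (lightConeMap φ η x).1 :=
  Real.exp_log (lightConeMap_fst_pos hη hφ x)

/-- If the hyperbolic Gauss map is the identity, then `ψ = e^ρ (1, x)`. -/
theorem lightConeMap_eq (hη : IsUnitNormal φ η) (hφ : IsImmersedHypersurface φ)
    (hG : ∀ x : Sph n, hyperbolicGaussMap φ η x = x) (x : Sph n) :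
    lightConeMap φ η x = (Real.exp (logSupport φ η x),
      Real.exp (logSupport φ η x) • (x : EuclideanSpace ℝ (Fin (n + 1)))) := by
  have h := hG x
  rw [hyperbolicGaussMap, inv_smul_eq_iff₀ (lightConeMap_fst_pos hη hφ x).ne'] at h
  rw [exp_logSupport hη hφ, ← h]

/-- The differential of `ψ = e^ρ (1, x)`. -/
theorem mvfderiv_lightConeMap (hη : IsUnitNormal φ η) (hφ : IsImmersedHypersurface φ)
    (hG : ∀ x : Sph n, hyperbolicGaussMap φ η x = x) {x : Sph n}
    {U : Coord n →ₗᵢ[ℝ] EuclideanSpace ℝ (Fin (n + 1))}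
    (hP : ∀ u, (((extChartAt (𝓡 n) x).symm u : Sph n) : EuclideanSpace ℝ (Fin (n + 1))) =
        stereoParam U x u) (X : TangentSpace (𝓡 n) x) :
    mvfderiv (𝓡 n) (lightConeMap φ η) x X =
      Real.exp (logSupport φ η x) • (fderiv ℝ (logSupport φ η ∘ (extChartAt (𝓡 n) x).symm) 0
        (chartVector x X) • ((1 : ℝ), (x : EuclideanSpace ℝ (Fin (n + 1))))
        + ((0 : ℝ), U (chartVector x X))) := by
  have hr := contDiff_comp_extChartAt_symm (contMDiff_logSupport hη hφ) x
  have hx0 : (extChartAt (𝓡 n) x).symm 0 = x := by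
    rw [← extChartAt_sphere_self x, extChartAt_to_inv]
  have hr0 : (logSupport φ η ∘ (extChartAt (𝓡 n) x).symm) 0 = logSupport φ η x :=
    congrArg _ hx0
  have hψ : lightConeMap φ η ∘ (extChartAt (𝓡 n) x).symm = fun u =>
      (Real.exp ((logSupport φ η ∘ (extChartAt (𝓡 n) x).symm) u),
        Real.exp ((logSupport φ η ∘ (extChartAt (𝓡 n) x).symm) u) • stereoParam U x u) := by
    funext u
    rw [Function.comp_apply, lightConeMap_eq hη hφ hG, hP]
    rfl
  rw [mvfderiv_eq_fderiv_chart (contMDiff_lightConeMap hη hφ), hψ, ← hr0]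
  generalize logSupport φ η ∘ (extChartAt (𝓡 n) x).symm = r at *
  have dr := (hr.differentiable (by simp) 0).hasFDerivAt.exp
  have dP := ((contDiff_stereoParam U (x : EuclideanSpace ℝ (Fin (n + 1)))).differentiable
    (by simp) 0).hasFDerivAt
  rw [(dr.prodMk (dr.fun_smul dP)).fderiv]
  ext1
  · simp
  · simp [stereoParam_zero, fderiv_stereoParam_zero, smul_smul, add_comm]

/-- The vector (1, x) is null and orthogonal to every (0, U w), so the dρ terms of dψ contribute
nothing. -/
theorem horosphericalMetric_eq (hη : IsUnitNormal φ η) (hφ : IsImmersedHypersurface φ)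
    (hG : ∀ x : Sph n, hyperbolicGaussMap φ η x = x) :
    horosphericalMetric φ η = conformalMetric (logSupport φ η) := by
  funext x X Y
  obtain ⟨U, hU, -, hP⟩ := exists_chart_symm_eq_stereoParam x
  have hU' : ∀ w, ⟪(x : EuclideanSpace ℝ (Fin (n + 1))), U w⟫_ℝ = 0 := fun w => by
    rw [real_inner_comm, hU]
  rw [horosphericalMetric, conformalMetric, roundMetric_eq_inner,
    mvfderiv_lightConeMap hη hφ hG hP, mvfderiv_lightConeMap hη hφ hG hP, two_mul, Real.exp_add]
  simp [lorentz, inner_add_left, inner_add_right, real_inner_smul_left, real_inner_smul_right, hU,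
    hU', U.inner_map_map]
  ring

theorem lorentz_fderiv_self (hφ : IsImmersedHypersurface φ) (x : Sph n) (u w : Coord n) :
    lorentz (fderiv ℝ (φ ∘ (extChartAt (𝓡 n) x).symm) u w)
      (φ ((extChartAt (𝓡 n) x).symm u)) = 0 := by
  have hf := contDiff_comp_extChartAt_symm hφ.smooth x
  have h1 (v : Coord n) : lorentz ((φ ∘ (extChartAt (𝓡 n) x).symm) v)
    ((φ ∘ (extChartAt (𝓡 n) x).symm) v) = -1 := (hφ.mem_hyperbolicSpace _).1
  change lorentz _ ((φ ∘ (extChartAt (𝓡 n) x).symm) u) = 0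
  generalize φ ∘ (extChartAt (𝓡 n) x).symm = f at *
  have df := (hf.differentiable (by simp) u).hasFDerivAt
  have h := (df.fst.fun_mul df.fst).fun_neg.fun_add (df.snd.inner ℝ df.snd)
  simp only [lorentz] at h1
  rw [funext h1] at h
  have he := congrArg (fun L => L w) (h.unique (hasFDerivAt_const _ _))
  simp [fderivInnerCLM_apply, real_inner_comm] at he
  rw [lorentz, real_inner_comm]
  linarith

/-- The tangent vectors of the hypersurface are orthogonal to the light cone map. -/
theorem lorentz_fderiv_lightConeMap (hη : IsUnitNormal φ η) (hφ : IsImmersedHypersurface φ)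
    (x : Sph n) (u w : Coord n) :
    lorentz (fderiv ℝ (φ ∘ (extChartAt (𝓡 n) x).symm) u w)
      (lightConeMap φ η ((extChartAt (𝓡 n) x).symm u)) = 0 := by
  rw [lightConeMap, lorentz_add_right, lorentz_fderiv_self hφ,
    ← mvfderiv_mfderiv_extChartAt_symm hφ.smooth, lorentz_comm, hη.normal, add_zero]

/-- In the coordinates `U` of the tangent space at `x`, the bilinear form `⟨dφ, dψ⟩` equals
`½ g - Sch_g`, and the first fundamental form is the sum of the squares of its components. -/
theorem lorentz_mvfderiv_lightConeMap (hη : IsUnitNormal φ η) (hφ : IsImmersedHypersurface φ)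
    (hG : ∀ x : Sph n, hyperbolicGaussMap φ η x = x) (x : Sph n) :
    ∃ U : Coord n →ₗᵢ[ℝ] EuclideanSpace ℝ (Fin (n + 1)),
      (∀ X Y : TangentSpace (𝓡 n) x,
        lorentz (mvfderiv (𝓡 n) φ x X) (mvfderiv (𝓡 n) (lightConeMap φ η) x Y) =
          Real.exp (logSupport φ η x) *
            ⟪(mvfderiv (𝓡 n) φ x X).2, U (chartVector x Y)⟫_ℝ) ∧
      (∀ X Y : TangentSpace (𝓡 n) x,
        lorentz (mvfderiv (𝓡 n) φ x X) (mvfderiv (𝓡 n) (lightConeMap φ η) x Y) =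
          (1 / 2) * horosphericalMetric φ η x X Y
            - conformalSchoutenFormula (logSupport φ η) x X Y) ∧
      ∀ (b : OrthonormalBasis (Fin n) ℝ (Coord n)) (X Y : TangentSpace (𝓡 n) x),
        firstForm φ x X Y = ∑ k, ⟪(mvfderiv (𝓡 n) φ x X).2, U (b k)⟫_ℝ *
          ⟪(mvfderiv (𝓡 n) φ x Y).2, U (b k)⟫_ℝ := by
  obtain ⟨U, hU, hs, hP⟩ := exists_chart_symm_eq_stereoParam x
  have hx := norm_eq_of_mem_sphere x
  have hf := contDiff_comp_extChartAt_symm hφ.smooth x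
  have hr := contDiff_comp_extChartAt_symm (contMDiff_logSupport hη hφ) x
  have hx0 : (extChartAt (𝓡 n) x).symm 0 = x := by
    rw [← extChartAt_sphere_self x, extChartAt_to_inv]
  have hr0 : (logSupport φ η ∘ (extChartAt (𝓡 n) x).symm) 0 = logSupport φ η x :=
    congrArg _ hx0
  have h3 (u w : Coord n) : -(fderiv ℝ (φ ∘ (extChartAt (𝓡 n) x).symm) u w).1 +
      ⟪(fderiv ℝ (φ ∘ (extChartAt (𝓡 n) x).symm) u w).2, stereoParam U x u⟫_ℝ = 0 := by
    have h := lorentz_fderiv_lightConeMap hη hφ x u w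
    rw [lightConeMap_eq hη hφ hG, hP, lorentz] at h
    simp only [real_inner_smul_right] at h
    have hp := Real.exp_pos (logSupport φ η ((extChartAt (𝓡 n) x).symm u))
    apply mul_left_cancel₀ hp.ne'
    linarith
  -- Thus dφ(X) is a multiple of the null vector (1, x) plus a vector (0, U w).
  have h30 (X : TangentSpace (𝓡 n) x) : (mvfderiv (𝓡 n) φ x X).1 =
      ⟪(mvfderiv (𝓡 n) φ x X).2, (x : EuclideanSpace ℝ (Fin (n + 1)))⟫_ℝ := by
    have h := h3 0 (chartVector x X)
    rw [stereoParam_zero, ← mvfderiv_eq_fderiv_chart hφ.smooth] at h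
    linarith
  have hB (X Y : TangentSpace (𝓡 n) x) :
      lorentz (mvfderiv (𝓡 n) φ x X) (mvfderiv (𝓡 n) (lightConeMap φ η) x Y) =
        Real.exp (logSupport φ η x) * ⟪(mvfderiv (𝓡 n) φ x X).2, U (chartVector x Y)⟫_ℝ := by
    rw [mvfderiv_lightConeMap hη hφ hG hP]
    simp [lorentz, inner_add_right, real_inner_smul_right, h30]
    ring
  refine ⟨U, hB, fun X Y => ?_, fun b X Y => ?_⟩
  · rw [hB, horosphericalMetric_eq hη hφ hG, conformalMetric, roundMetric_eq_inner,
      conformalSchoutenFormula_eq (contMDiff_logSupport hη hφ), ← hr0,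
      mvfderiv_eq_fderiv_chart hφ.smooth]
    have d (u : Coord n) := (hf.differentiable (by simp) u).hasFDerivAt
    have ea (u w : Coord n) : fderiv ℝ (fun v => ((φ ∘ (extChartAt (𝓡 n) x).symm) v).1) u w =
      (fderiv ℝ (φ ∘ (extChartAt (𝓡 n) x).symm) u w).1 := by rw [(d u).fst.fderiv]; rfl
    have ey (u w : Coord n) : fderiv ℝ (fun v => ((φ ∘ (extChartAt (𝓡 n) x).symm) v).2) u w =
      (fderiv ℝ (φ ∘ (extChartAt (𝓡 n) x).symm) u w).2 := by rw [(d u).snd.fderiv]; rfl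
    rw [← ey, exp_mul_inner_fderiv U hx hU hs hf.fst hr hf.snd
      (fun u => (hφ.mem_hyperbolicSpace _).1) (fun u => ?_) (fun u w => by rw [ea, ey, h3])]
    · ring
    · have h := lorentz_lightConeMap hη hφ ((extChartAt (𝓡 n) x).symm u)
      rw [lightConeMap_eq hη hφ hG, hP, lorentz] at h
      simp only [real_inner_smul_right] at h
      have hp := Real.exp_pos (logSupport φ η ((extChartAt (𝓡 n) x).symm u))
      apply mul_left_cancel₀ hp.ne'
      simp only [Function.comp_apply]
      rw [Real.exp_neg, mul_neg, mul_inv_cancel₀ hp.ne']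
      linarith
  -- The time components cancel the components along x, which leaves the tangential sum.
  · rw [firstForm, lorentz, inner_eq_sum_of_orthogonal U hx hU hs b, h30, h30]
    ring

/-- The chart coordinates of a `g₀`-orthonormal basis form an orthonormal basis of `ℝⁿ`. -/
theorem exists_orthonormalBasis_chartVector {x : Sph n} {e : Fin n → TangentSpace (𝓡 n) x}
    (he : ∀ i j, roundMetric n x (e i) (e j) = if i = j then 1 else 0) :
    ∃ b : OrthonormalBasis (Fin n) ℝ (Coord n), ∀ i, b i = chartVector x (e i) := by
  have ho : Orthonormal ℝ fun i => chartVector x (e i) :=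
    orthonormal_iff_ite.2 fun i j => by rw [← roundMetric_eq_inner, he]
  have hs : ⊤ ≤ Submodule.span ℝ (Set.range fun i => chartVector x (e i)) :=
    (ho.linearIndependent.span_eq_top_of_card_eq_finrank' (by simp)).ge
  exact ⟨OrthonormalBasis.mk ho hs, fun i => by simp⟩

theorem roundMetric_comm (x : Sph n) (X Y : TangentSpace (𝓡 n) x) :
    roundMetric n x X Y = roundMetric n x Y X := real_inner_comm _ _

/-- Second derivatives commute. The symmetry is what turns the product of a matrix with its
transpose, in the first fundamental form, into a square. -/
theorem conformalSchoutenFormula_comm {ρ : Sph n → ℝ} (hρ : ContMDiff (𝓡 n) 𝓘(ℝ) ∞ ρ)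
    (x : Sph n) (X Y : TangentSpace (𝓡 n) x) :
    conformalSchoutenFormula ρ x X Y = conformalSchoutenFormula ρ x Y X := by
  have hr := contDiff_comp_extChartAt_symm hρ x
  have hh : hessian (roundMetric n) ρ x X Y = hessian (roundMetric n) ρ x Y X := by
    rw [hessian_roundMetric hρ, hessian_roundMetric hρ, ← ofChartMatrix_pderiv_pderiv hr,
      ← ofChartMatrix_pderiv_pderiv hr, ofChartMatrix, ofChartMatrix, Finset.sum_comm]
    refine Finset.sum_congr rfl fun i _ => Finset.sum_congr rfl fun j _ => ?_
    rw [pderiv_comm hr]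
    ring
  rw [conformalSchoutenFormula, conformalSchoutenFormula, roundMetric_comm, hh]
  ring

end GaussMap
end HoroGeom

/-! ### The main theorem. -/

open HoroGeom in
theorem mainTheorem3 (n : ℕ) (hn : 2 ≤ n) (φ η : Sph n → Minkowski n)
    (hφ : IsHorosphericalOvaloid φ) (hη : IsUnitNormal φ η)
    (hG : ∀ x : Sph n, hyperbolicGaussMap φ η x = x) :
    -- the horospherical metric `g` is `e^{2ρ} g₀`
    horosphericalMetric φ η = conformalMetric (logSupport φ η) ∧
    -- `Sch_g = -∇²ρ + dρ ⊗ dρ - ½ (-1 + |∇ρ|²) g₀`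
    schouten (logSupport φ η) = conformalSchoutenFormula (logSupport φ η) ∧
    -- the first fundamental form, as an identity of matrices in any `g₀`-orthonormal basis
    (∀ (x : Sph n) (e : Fin n → TangentSpace (𝓡 n) x),
      (∀ i j, roundMetric n x (e i) (e j) = if i = j then 1 else 0) →
      Matrix.of (fun i j => firstForm φ x (e i) (e j)) =
        (Real.exp (-2 * logSupport φ η x) / 4) •
          Matrix.of (fun i j => horosphericalMetric φ η x (e i) (e j)
            - 2 * schouten (logSupport φ η) x (e i) (e j)) ^ 2) ∧
    -- the second fundamental form
    (∀ (x : Sph n) (X Y : TangentSpace (𝓡 n) x),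
      secondForm φ η x X Y = firstForm φ x X Y - (1 / 2) * horosphericalMetric φ η x X Y
        + schouten (logSupport φ η) x X Y) := by
  have hi := hφ.2.1
  have hρ := contMDiff_logSupport hη hi
  have hS := schouten_eq_conformalSchoutenFormula hρ
  refine ⟨horosphericalMetric_eq hη hi hG, hS, fun x e he => ?_, fun x X Y => ?_⟩
  · obtain ⟨U, hB, hC, hI⟩ := lorentz_mvfderiv_lightConeMap hη hi hG x
    obtain ⟨b, hb⟩ := exists_orthonormalBasis_chartVector he
    have hM (i j : Fin n) : horosphericalMetric φ η x (e i) (e j)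
        - 2 * schouten (logSupport φ η) x (e i) (e j) = 2 * (Real.exp (logSupport φ η x) *
          ⟪(mvfderiv (𝓡 n) φ x (e i)).2, U (b j)⟫_ℝ) := by
      rw [hb, ← hB, hC, hS]
      ring
    -- The transposed reading of `hM`: row i of the first factor and column j of the second then
    -- give the tangential components of dφ(eᵢ) and dφ(eⱼ).
    have hM' (i j : Fin n) : horosphericalMetric φ η x (e i) (e j)
        - 2 * schouten (logSupport φ η) x (e i) (e j) = 2 * (Real.exp (logSupport φ η x) *
          ⟪(mvfderiv (𝓡 n) φ x (e j)).2, U (b i)⟫_ℝ) := by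
      rw [← hM, hS, conformalSchoutenFormula_comm hρ, horosphericalMetric, lorentz_comm,
        horosphericalMetric]
    have hexp : Real.exp (-2 * logSupport φ η x) * Real.exp (logSupport φ η x) ^ 2 = 1 := by
      rw [sq, ← Real.exp_add, ← Real.exp_add, Real.exp_eq_one_iff]
      ring
    ext i j
    rw [Matrix.of_apply, hI b, sq, Matrix.smul_apply, Matrix.mul_apply, smul_eq_mul,
      Finset.mul_sum]
    refine Finset.sum_congr rfl fun k _ => ?_
    rw [Matrix.of_apply, Matrix.of_apply, hM i k, hM' k j]
    linear_combination -(⟪(mvfderiv (𝓡 n) φ x (e i)).2, U (b k)⟫_ℝ *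
      ⟪(mvfderiv (𝓡 n) φ x (e j)).2, U (b k)⟫_ℝ) * hexp
  · obtain ⟨-, -, hC, -⟩ := lorentz_mvfderiv_lightConeMap hη hi hG x
    -- From dψ = dφ + dη, ⟨dφ, dψ⟩ = I - II.
    have hadd : mvfderiv (𝓡 n) (lightConeMap φ η) x Y =
        mvfderiv (𝓡 n) φ x Y + mvfderiv (𝓡 n) η x Y := by
      have := mvfderiv_fun_add ((hi.smooth x).mdifferentiableAt (by simp))
        ((hη.smooth x).mdifferentiableAt (by simp))
      exact congrArg (fun L => L Y) this
    have h := hC X Y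
    rw [hadd, lorentz_add_right] at h
    rw [hS, secondForm, firstForm]
    linarith
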